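/- For integers $d\ge 1$ and $k\ge 1$ let $$T=T(d,k)=(1,2,\ldots,d-1,\underbrace{d,\ldots,d}_{k},d-1,\ldots,2,1),$$ that is, $T_i=i+1$ for $0\le i\le d-1$, $T_i=d$ for $d-1\le i\le d+k-2$, $T_i=2d+k-2-i$ for $d+k-1\le i\le 2d+k-3$, and $T_i=0$ for $i>2d+k-3$. (These are the Hilbert functions of the graded Artinian complete intersection quotients of a polynomial ring in two variables.) A partition $P=(p_1\ge p_2\ge\cdots\ge p_s>0)$ has diagonal lengths $T$ if for every $m\ge 0$ its Ferrers diagram $\{(i,j)\mid 0\le i<s,\ 0\le j<p_{i+1}\}$ contains exactly $T_m$ boxes $(i,j)$ with $i+j=m$. If $k>1$, there are exactly $2\cdot 3^{d-1}$ partitions having diagonal lengths $T$; if $k=1$, there are exactly $3^{d-1}$ such partitions. Moreover, let $\mathsf k$ be a field and $R=\mathsf k[x,y]$ with the standard grading. A partition $P$ has diagonal lengths $T$ if and only if there are a homogeneous ideal $I\subset R$ such that $A=R/I$ has Hilbert function $T$ (i.e. $\dim_{\mathsf k}A_i=T_i$ for all $i\ge 0$; $A$ need not be a complete intersection) and a nonzero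 linear form $\ell\in R_1$ such that $P$ is the Jordan type of $\ell$ on $A$, that is, the parts of $P$ are the sizes of the Jordan blocks of the nilpotent $\mathsf k$-linear map $A\to A$, $a\mapsto \ell a$. -/

import Mathlib

attribute [local instance] MvPolynomial.gradedAlgebra

/-- The sequence `T(d,k) = (1, 2, …, d-1, d, …, d, d-1, …, 2, 1, 0, 0, …)`, in which the maximal
value `d` is repeated `k` times: `T i = i + 1` for `i ≤ d - 1`, `T i = d` for
`d - 1 ≤ i ≤ d + k - 2`, and `T i = 2 d + k - 2 - i` for `d + k - 1 ≤ i ≤ 2 d + k - 3`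
(the natural number subtraction makes it `0` afterwards). -/
def ciHilbertFunction (d k : ℕ) (i : ℕ) : ℕ :=
  if i + 1 ≤ d then i + 1
  else if i + 2 ≤ d + k then d
  else 2 * d + k - (i + 2)

/-- The diagonal lengths of a partition, given by its Ferrers diagram: the `m`-th one is the number
of boxes `(i, j)` (row `i`, column `j`, both counted from `0`) on the diagonal `i + j = m`. -/
def YoungDiagram.diagonalLengths (P : YoungDiagram) (m : ℕ) : ℕ :=
  (P.cells.filter fun c => c.1 + c.2 = m).card

/-- The partition `P` is the Jordan type of the nilpotent endomorphism `f` of `V`: there is a basis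
of `V` indexed by the boxes of the Ferrers diagram of `P` such that `f` maps each basis vector to
the one in the next box of the same row, and to `0` at the end of a row. Thus each row of `P`
of length `q` is one Jordan block of size `q` for the eigenvalue `0`. -/
def HasJordanType {K V : Type*} [Field K] [AddCommGroup V] [Module K V]
    (f : V →ₗ[K] V) (P : YoungDiagram) : Prop :=
  ∃ b : Module.Basis {c : ℕ × ℕ // c ∈ P.cells} K V,
    ∀ c : {c : ℕ × ℕ // c ∈ P.cells},
      f (b c) = if h : (c.1.1, c.1.2 + 1) ∈ P.cells then b ⟨(c.1.1, c.1.2 + 1), h⟩ else 0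

/-- The Hilbert function of `A = K[x,y]/I` (used for homogeneous ideals `I`): the dimension of the
degree `i` component `A_i`, the image in `A` of the space of forms of degree `i`. -/
noncomputable def quotientHilbertFunction {K : Type*} [Field K]
    (I : Ideal (MvPolynomial (Fin 2) K)) (i : ℕ) : ℕ :=
  Module.finrank K
    ((MvPolynomial.homogeneousSubmodule (Fin 2) K i).map (Ideal.Quotient.mkₐ K I).toLinearMap)

/-- `P` occurs as the Jordan type of multiplication by a nonzero linear form `ℓ` of `K[x,y]` on a
graded quotient `A = K[x,y]/I` whose Hilbert function is `T`. -/
def OccursAsJordanType (K : Type*) [Field K] (T : ℕ → ℕ) (P : YoungDiagram) : Prop :=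
  ∃ I : Ideal (MvPolynomial (Fin 2) K),
    I.IsHomogeneous (MvPolynomial.homogeneousSubmodule (Fin 2) K) ∧
    quotientHilbertFunction I = T ∧
    ∃ ℓ : MvPolynomial (Fin 2) K, ℓ.IsHomogeneous 1 ∧ ℓ ≠ 0 ∧
      HasJordanType (LinearMap.mulLeft K (Ideal.Quotient.mk I ℓ)) P

/-! Counting. The last nonzero entry of `T(d,k)` is a 1 in degree `2d+k-3`, so a partition with
these diagonal lengths has exactly one box there, in some row `c`. If `c < d`, the first `c+1` rows
all have length `2d+k-2-c`, and deleting them leaves an arbitrary partition with diagonal lengths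
`T(d-1-c,k)` (`bijOn_addRows`). Transposition handles the mirror positions (`ncard_last_symm`), and
no position strictly between the two ranges occurs (`last_eq_empty`). With `a d` the number of
partitions, `a 0 = 1`, this gives `a d = 2 * ∑ c < d, a c` for `k > 1`. For `k = 1` the two ranges
share their middle row, which is the `+ 1` in `a d + 1 = 2 * ∑ c < d, a c`.

Jordan types. Complete `ℓ` to a basis `z, ℓ` of the linear forms and take the monomials `z^i ℓ^j`
outside `I + (ℓ^(j+1))`. Their exponents form a Young diagram `D`, and their classes form a
homogeneous basis of `A`, so the diagonal lengths of `D` are the Hilbert function. Those with `j ≥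
t` span `ℓ^t A`, so the ranks of all powers of `ℓ` agree with those of Jordan type `D`; the ranks
determine the partition, hence it is `D`. Conversely, a diagram `P` is the Jordan type of `y` on the
quotient by the monomials outside `P`. No assumption on the field enters. -/

namespace YoungDiagram

/-! ### Diagonal lengths and transposition -/

/-- The set of partitions with diagonal lengths `T(d,k)`. -/
def withCIDiagonals (d k : ℕ) : Set YoungDiagram :=
  {P | P.diagonalLengths = ciHilbertFunction d k}

theorem mem_withCIDiagonals {d k : ℕ} {P : YoungDiagram} :
    P ∈ withCIDiagonals d k ↔ ∀ m, P.diagonalLengths m = ciHilbertFunction d k m :=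
  funext_iff

theorem diagonalLengths_eq_card_range (P : YoungDiagram) (m : ℕ) :
    P.diagonalLengths m = ((Finset.range (m + 1)).filter fun i => (i, m - i) ∈ P).card := by
  unfold diagonalLengths
  refine Finset.card_nbij' (fun c => c.1) (fun i => (i, m - i)) ?_ ?_ ?_ ?_
  · rintro ⟨i, j⟩ h
    simp only [Finset.coe_filter, mem_cells, Set.mem_ofPred_eq, Finset.mem_range] at h ⊢
    obtain ⟨h, rfl⟩ := h
    refine ⟨by omega, ?_⟩
    rwa [Nat.add_sub_cancel_left]
  · intro i h
    simp only [Finset.coe_filter, mem_cells, Set.mem_ofPred_eq, Finset.mem_range] at h ⊢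
    exact ⟨h.2, by omega⟩
  · rintro ⟨i, j⟩ h
    simp only [Finset.coe_filter, mem_cells, Set.mem_ofPred_eq] at h ⊢
    ext <;> simp; omega
  · intro i _
    rfl

theorem diagonalLengths_transpose (P : YoungDiagram) :
    P.transpose.diagonalLengths = P.diagonalLengths := by
  ext m
  unfold diagonalLengths
  refine Finset.card_nbij' Prod.swap Prod.swap ?_ ?_ ?_ ?_
  · rintro ⟨i, j⟩ h
    simpa [mem_transpose, add_comm] using h
  · rintro ⟨i, j⟩ h
    simpa [mem_transpose, add_comm] using h
  · intro c _; simp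
  · intro c _; simp

theorem transpose_mem_withCIDiagonals {d k : ℕ} {P : YoungDiagram} :
    P.transpose ∈ withCIDiagonals d k ↔ P ∈ withCIDiagonals d k := by
  simp [withCIDiagonals, diagonalLengths_transpose]

theorem diagonalLengths_pos_iff (P : YoungDiagram) (m : ℕ) :
    0 < P.diagonalLengths m ↔ ∃ c ∈ P, c.1 + c.2 = m := by
  simp [diagonalLengths, Finset.card_pos, Finset.Nonempty]

/-! ### Adding and removing a block of equal rows -/

/-- Put `p` rows of length `n` on top of a diagram (cut down to its first `n` columns). -/
def addRows (p n : ℕ) (P : YoungDiagram) : YoungDiagram where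
  cells := Finset.range p ×ˢ Finset.range n ∪
    (P.cells.filter fun c => c.2 < n).image fun c => (c.1 + p, c.2)
  isLowerSet := by
    rintro ⟨i, j⟩ ⟨i', j'⟩ hle h
    obtain ⟨hi, hj⟩ : i' ≤ i ∧ j' ≤ j := hle
    simp only [Finset.coe_union, Set.mem_union, Finset.mem_coe, Finset.mem_product,
      Finset.mem_range, Finset.mem_image, Finset.mem_filter, mem_cells, Prod.mk.injEq,
      Prod.exists] at h ⊢
    by_cases hp : i' < p
    · left
      rcases h with h | ⟨a, b, h, rfl, rfl⟩ <;> omega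
    · right
      rcases h with h | ⟨a, b, ⟨h, hb⟩, rfl, rfl⟩
      · omega
      · exact ⟨i' - p, j', ⟨P.up_left_mem (by omega) hj h, by omega⟩, by omega, rfl⟩

theorem mem_addRows {p n : ℕ} {P : YoungDiagram} {i j : ℕ} :
    (i, j) ∈ addRows p n P ↔ j < n ∧ (i < p ∨ (i - p, j) ∈ P) := by
  rw [← mem_cells]
  simp only [addRows, Finset.mem_union, Finset.mem_product,
      Finset.mem_range, Finset.mem_image, Finset.mem_filter, mem_cells, Prod.mk.injEq,
      Prod.exists]
  constructor
  · rintro (h | ⟨a, b, ⟨h, hb⟩, rfl, rfl⟩)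
    · exact ⟨h.2, Or.inl h.1⟩
    · exact ⟨hb, Or.inr (by simpa using h)⟩
  · rintro ⟨hj, h⟩
    by_cases hp : i < p
    · exact Or.inl ⟨hp, hj⟩
    · exact Or.inr ⟨i - p, j, ⟨h.resolve_left hp, hj⟩, by omega, rfl⟩

/-- Remove the first `p` rows of a diagram. -/
def dropRows (p : ℕ) (P : YoungDiagram) : YoungDiagram where
  cells := (P.cells.filter fun c => p ≤ c.1).image fun c => (c.1 - p, c.2)
  isLowerSet := by
    rintro ⟨i, j⟩ ⟨i', j'⟩ hle h
    obtain ⟨hi, hj⟩ : i' ≤ i ∧ j' ≤ j := hle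
    simp only [Finset.mem_coe, Finset.mem_image, Finset.mem_filter, mem_cells, Prod.mk.injEq,
      Prod.exists] at h ⊢
    obtain ⟨a, b, ⟨h, ha⟩, rfl, rfl⟩ := h
    exact ⟨i' + p, j', ⟨P.up_left_mem (by omega) hj h, by omega⟩, by omega, rfl⟩

theorem mem_dropRows {p : ℕ} {P : YoungDiagram} {i j : ℕ} :
    (i, j) ∈ dropRows p P ↔ (i + p, j) ∈ P := by
  rw [← mem_cells]
  simp only [dropRows, Finset.mem_image, Finset.mem_filter, mem_cells, Prod.mk.injEq,
      Prod.exists]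
  constructor
  · rintro ⟨a, b, ⟨h, ha⟩, rfl, rfl⟩
    rwa [Nat.sub_add_cancel ha]
  · intro h
    exact ⟨i + p, j, ⟨h, by omega⟩, by omega, rfl⟩

theorem ext_mem {P Q : YoungDiagram} (h : ∀ i j, (i, j) ∈ P ↔ (i, j) ∈ Q) : P = Q :=
  SetLike.ext fun ⟨i, j⟩ => h i j

theorem dropRows_addRows {p n : ℕ} {P : YoungDiagram} (h : ∀ i j, (i, j) ∈ P → j < n) :
    dropRows p (addRows p n P) = P := by
  refine ext_mem fun i j => ?_
  rw [mem_dropRows, mem_addRows]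
  have := h i j
  simp
  tauto

theorem addRows_dropRows {p n : ℕ} {P : YoungDiagram} (h : ∀ i j, (i, j) ∈ P → j < n)
    (hr : ∀ i j, i < p → j < n → (i, j) ∈ P) :
    addRows p n (dropRows p P) = P := by
  refine ext_mem fun i j => ?_
  rw [mem_addRows, mem_dropRows]
  have h1 := h i j
  have h2 := hr i j
  by_cases hp : i < p
  · tauto
  · rw [Nat.sub_add_cancel (by omega)]
    tauto

theorem diagonalLengths_addRows {p n : ℕ} {P : YoungDiagram} (h : ∀ i j, (i, j) ∈ P → j < n)
    (m : ℕ) :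
    (addRows p n P).diagonalLengths m =
      (min p (m + 1) - (m + 1 - n)) + if p ≤ m then P.diagonalLengths (m - p) else 0 := by
  -- The rectangle meets diagonal `m` in the rows `i < p` with `0 ≤ m - i < n`; the remaining rows
  -- come from `P`, shifted down by `p`.
  have hset : ((Finset.range (m + 1)).filter fun i => (i, m - i) ∈ addRows p n P) =
      Finset.Ico (m + 1 - n) (min p (m + 1)) ∪
        if p ≤ m then ((Finset.range (m - p + 1)).filter fun i => (i, m - p - i) ∈ P).image (· + p)
          else ∅ := by
    ext i
    simp only [Finset.mem_filter, Finset.mem_range, mem_addRows, Finset.mem_union, Finset.mem_Ico]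
    by_cases hip : i < p
    · have : ¬ (i ∈ if p ≤ m then
          ((Finset.range (m - p + 1)).filter fun i => (i, m - p - i) ∈ P).image (· + p)
          else ∅) := by
        split_ifs <;> simp; omega
      simp only [this, hip, true_or, and_true, or_false]
      omega
    · by_cases hpm : p ≤ m
      · simp only [hpm, if_true, Finset.mem_image, Finset.mem_filter, Finset.mem_range]
        constructor
        · rintro ⟨h1, h2, h3⟩
          right
          refine ⟨i - p, ⟨by omega, ?_⟩, by omega⟩
          rw [show m - p - (i - p) = m - i by omega]
          exact h3.resolve_left hip
        · rintro (h1 | ⟨a, ⟨h1, h2⟩, rfl⟩)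
          · omega
          · have := h _ _ h2
            refine ⟨by omega, by omega, Or.inr ?_⟩
            rwa [Nat.add_sub_cancel, show m - (a + p) = m - p - a by omega]
      · simp only [hpm, if_false, Finset.notMem_empty, or_false]
        exact ⟨fun h => by have := h.1; omega, fun h => by omega⟩
  rw [diagonalLengths_eq_card_range, hset, Finset.card_union_of_disjoint]
  · rw [Nat.card_Ico]
    split_ifs
    · rw [Finset.card_image_of_injective _ (add_left_injective p), diagonalLengths_eq_card_range]
    · simp
  · rw [Finset.disjoint_left]
    intro i hi
    rw [Finset.mem_Ico] at hi
    split_ifs <;> simp; omega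

/-! ### Position of the box on the last diagonal -/

theorem ciHilbertFunction_eq_add {d k p : ℕ} (hk : 1 ≤ k) (hp : 1 ≤ p) (hpd : p ≤ d) (m : ℕ) :
    ciHilbertFunction d k m = (min p (m + 1) - (m + 1 - (2 * d + k - 1 - p))) +
      if p ≤ m then ciHilbertFunction (d - p) k (m - p) else 0 := by
  unfold ciHilbertFunction
  split_ifs <;> omega

theorem add_lt_of_mem_withCIDiagonals {d k : ℕ} {P : YoungDiagram} (hk : 1 ≤ k)
    (hP : P ∈ withCIDiagonals d k) {i j : ℕ} (h : (i, j) ∈ P) : i + j + 2 < 2 * d + k := by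
  have h1 : 0 < P.diagonalLengths (i + j) := (diagonalLengths_pos_iff _ _).2 ⟨_, h, rfl⟩
  rw [mem_withCIDiagonals.1 hP] at h1
  unfold ciHilbertFunction at h1
  split_ifs at h1 <;> omega

/-- The partitions with diagonal lengths `T(d,k)` whose box on the last diagonal is in row `c`. -/
def withCIDiagonalsLast (d k c : ℕ) : Set YoungDiagram :=
  {P ∈ withCIDiagonals d k | (c, 2 * d + k - 3 - c) ∈ P}

/-- Needed because `ncard` is 0 on infinite sets. -/
theorem withCIDiagonals_finite (d : ℕ) {k : ℕ} (hk : 1 ≤ k) : (withCIDiagonals d k).Finite := by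
  refine Set.Finite.of_finite_image (f := cells) ?_ (fun P _ Q _ h => YoungDiagram.ext h)
  refine Set.Finite.subset (Finset.finite_toSet
    (Finset.range (2 * d + k) ×ˢ Finset.range (2 * d + k)).powerset) ?_
  rintro _ ⟨P, hP, rfl⟩
  simp only [Finset.coe_powerset, Set.mem_preimage, Set.mem_powerset_iff, Finset.coe_subset]
  rintro ⟨i, j⟩ h
  have := add_lt_of_mem_withCIDiagonals hk hP ((mem_cells _).1 h)
  simp
  omega

/-- A box in column `n = 2d+k-2-c` or beyond would force `(0, n)` into `P`. Together with the boxes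
forced by the last one in rows `1, …, c`, diagonal `n` would have `c+1` boxes, whereas `T` takes the
value `c` there. -/
theorem snd_lt_of_mem_last {d k c : ℕ} (hk : 1 ≤ k) (hc : c < d) {P : YoungDiagram}
    (hP : P ∈ withCIDiagonalsLast d k c) {i j : ℕ} (h : (i, j) ∈ P) :
    j < 2 * d + k - 1 - (c + 1) := by
  obtain ⟨hT, hc'⟩ := hP
  by_contra! hj
  have h0 : (0, 2 * d + k - 1 - (c + 1)) ∈ P := P.up_left_mem (Nat.zero_le _) hj h
  have hlow : c + 1 ≤ P.diagonalLengths (2 * d + k - 1 - (c + 1)) := by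
    rw [diagonalLengths_eq_card_range]
    calc c + 1 = (Finset.range (c + 1)).card := by simp
      _ ≤ _ := Finset.card_le_card fun i hi => ?_
    simp only [Finset.mem_range, Finset.mem_filter] at hi ⊢
    refine ⟨by omega, ?_⟩
    rcases Nat.eq_zero_or_pos i with rfl | hi0
    · simpa using h0
    · exact P.up_left_mem (by omega) (by omega) hc'
  rw [mem_withCIDiagonals.1 hT] at hlow
  unfold ciHilbertFunction at hlow
  split_ifs at hlow <;> omega

theorem bijOn_addRows {d k c : ℕ} (hk : 1 ≤ k) (hc : c < d) :
    Set.BijOn (addRows (c + 1) (2 * d + k - 1 - (c + 1)))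
      (withCIDiagonals (d - 1 - c) k) (withCIDiagonalsLast d k c) := by
  have hlt : ∀ P ∈ withCIDiagonals (d - 1 - c) k, ∀ i j, (i, j) ∈ P →
      j < 2 * d + k - 1 - (c + 1) := by
    intro P hP i j h
    have := add_lt_of_mem_withCIDiagonals hk hP h
    omega
  have hd : d - 1 - c = d - (c + 1) := by omega
  refine ⟨fun P hP => ⟨?_, ?_⟩, fun P hP Q hQ h => ?_, fun P hP => ?_⟩
  · rw [mem_withCIDiagonals]
    intro m
    rw [diagonalLengths_addRows (hlt P hP), ciHilbertFunction_eq_add hk (Nat.le_add_left 1 c) hc]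
    rw [hd] at hP
    simp only [mem_withCIDiagonals.1 hP]
  · rw [mem_addRows]
    omega
  · rw [← dropRows_addRows (p := c + 1) (hlt P hP), h, dropRows_addRows (hlt Q hQ)]
  · have hlt' : ∀ i j, (i, j) ∈ P → j < 2 * d + k - 1 - (c + 1) :=
      fun i j => snd_lt_of_mem_last hk hc hP
    have heq : addRows (c + 1) (2 * d + k - 1 - (c + 1)) (dropRows (c + 1) P) = P :=
      addRows_dropRows hlt' fun i j hi hj => P.up_left_mem (by omega) (by omega) hP.2
    refine ⟨dropRows (c + 1) P, ?_, heq⟩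
    rw [mem_withCIDiagonals]
    intro m
    have h1 := mem_withCIDiagonals.1 hP.1 (m + (c + 1))
    rw [ciHilbertFunction_eq_add hk (Nat.le_add_left 1 c) hc, ← heq,
      diagonalLengths_addRows (fun i j h => hlt' _ j (mem_dropRows.1 h)), if_pos (by omega),
      if_pos (by omega), Nat.add_sub_cancel] at h1
    rw [hd]
    omega

theorem ncard_last_of_lt {d k c : ℕ} (hk : 1 ≤ k) (hc : c < d) :
    (withCIDiagonalsLast d k c).ncard = (withCIDiagonals (d - 1 - c) k).ncard :=
  (bijOn_addRows hk hc).ncard_eq.symm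

theorem ncard_last_symm {d k c : ℕ} (hc : c ≤ 2 * d + k - 3) :
    (withCIDiagonalsLast d k (2 * d + k - 3 - c)).ncard = (withCIDiagonalsLast d k c).ncard := by
  rw [← Set.ncard_image_of_injective _ (fun P Q h => transpose_eq_iff.1 h :
    Function.Injective transpose)]
  congr 1
  ext P
  constructor
  · rintro ⟨Q, ⟨hQ, h⟩, rfl⟩
    refine ⟨transpose_mem_withCIDiagonals.2 hQ, mem_transpose.2 ?_⟩
    rwa [Nat.sub_sub_self hc] at h
  · rintro ⟨hP, h⟩
    refine ⟨P.transpose, ⟨transpose_mem_withCIDiagonals.2 hP, ?_⟩, transpose_transpose P⟩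
    rw [mem_transpose, Nat.sub_sub_self hc]
    exact h

/-- Both coordinates of the last box would be at least `d`, so all `d+1` boxes of diagonal `d` would
lie in `P`, but `T` never exceeds `d`. -/
theorem last_eq_empty {d k c : ℕ} (hd : d ≤ c) (hc : c + d ≤ 2 * d + k - 3) :
    withCIDiagonalsLast d k c = ∅ := by
  rw [Set.eq_empty_iff_forall_notMem]
  rintro P ⟨hP, h⟩
  have hlow : d + 1 ≤ P.diagonalLengths d := by
    rw [diagonalLengths_eq_card_range, Finset.filter_true_of_mem]
    · simp
    · intro i hi
      rw [Finset.mem_range] at hi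
      exact P.up_left_mem (by omega) (by omega) h
  rw [mem_withCIDiagonals.1 hP] at hlow
  unfold ciHilbertFunction at hlow
  split_ifs at hlow <;> omega

theorem ncard_eq_sum_last {d k : ℕ} (hd : 1 ≤ d) (hk : 1 ≤ k) :
    (withCIDiagonals d k).ncard =
      ∑ c ∈ Finset.range (2 * d + k - 2), (withCIDiagonalsLast d k c).ncard := by
  classical
  have hfin : ∀ c, (withCIDiagonalsLast d k c).Finite := fun c =>
    (withCIDiagonals_finite d hk).subset fun P hP => hP.1
  have hU : (withCIDiagonals_finite d hk).toFinset =
      (Finset.range (2 * d + k - 2)).biUnion fun c => (hfin c).toFinset := by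
    ext P
    simp only [Set.Finite.mem_toFinset, Finset.mem_biUnion, Finset.mem_range]
    constructor
    · intro hP
      have h1 : 0 < P.diagonalLengths (2 * d + k - 3) := by
        rw [mem_withCIDiagonals.1 hP]
        unfold ciHilbertFunction
        split_ifs <;> omega
      obtain ⟨⟨i, j⟩, h, hij⟩ := (diagonalLengths_pos_iff _ _).1 h1
      simp only at hij
      refine ⟨i, by omega, hP, ?_⟩
      rwa [show 2 * d + k - 3 - i = j by omega]
    · rintro ⟨c, _, hP⟩
      exact hP.1
  rw [Set.ncard_eq_toFinset_card _ (withCIDiagonals_finite d hk), hU, Finset.card_biUnion]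
  · exact Finset.sum_congr rfl fun c _ => (Set.ncard_eq_toFinset_card _ (hfin c)).symm
  · intro a ha b hb hab
    rw [Finset.mem_coe, Finset.mem_range] at ha hb
    rw [Function.onFun, Finset.disjoint_left]
    intro P hPa hPb
    rw [Set.Finite.mem_toFinset] at hPa hPb
    -- The last diagonal has a single box, so it cannot lie in two different rows.
    have h2 : P.diagonalLengths (2 * d + k - 3) ≤ 1 := by
      rw [mem_withCIDiagonals.1 hPa.1]
      unfold ciHilbertFunction
      split_ifs <;> omega
    have := Finset.card_le_one.1 h2 (a, 2 * d + k - 3 - a)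
      (Finset.mem_filter.2 ⟨hPa.2, by simp only; omega⟩) (b, 2 * d + k - 3 - b)
      (Finset.mem_filter.2 ⟨hPb.2, by simp only; omega⟩)
    exact hab (congrArg Prod.fst this)

/-! ### Recursions for the number of partitions -/

theorem ncard_zero (k : ℕ) : (withCIDiagonals 0 k).ncard = 1 := by
  rw [Set.ncard_eq_one]
  refine ⟨⊥, ?_⟩
  have hT : ciHilbertFunction 0 k = fun _ => 0 := by
    ext m
    unfold ciHilbertFunction
    split_ifs <;> omega
  ext P
  rw [Set.mem_singleton_iff, mem_withCIDiagonals, hT]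
  constructor
  · intro h
    refine SetLike.ext fun c => ⟨fun hc => ?_, fun hc => absurd hc (notMem_bot c)⟩
    exact absurd (h (c.1 + c.2)) ((diagonalLengths_pos_iff _ _).2 ⟨c, hc, rfl⟩).ne'
  · rintro rfl m
    simp [diagonalLengths]

theorem ncard_recursion_of_one_lt {d k : ℕ} (hd : 1 ≤ d) (hk : 1 < k) :
    (withCIDiagonals d k).ncard = 2 * ∑ c ∈ Finset.range d, (withCIDiagonals c k).ncard := by
  have h1 : ∑ c ∈ Finset.range d, (withCIDiagonalsLast d k c).ncard =
      ∑ c ∈ Finset.range d, (withCIDiagonals c k).ncard := by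
    rw [← Finset.sum_range_reflect (fun c => (withCIDiagonals c k).ncard)]
    exact Finset.sum_congr rfl fun c hc => ncard_last_of_lt hk.le (Finset.mem_range.1 hc)
  rw [ncard_eq_sum_last hd hk.le, show 2 * d + k - 2 = d + (k - 2) + d by omega,
    Finset.sum_range_add, Finset.sum_range_add, h1,
    Finset.sum_eq_zero (s := Finset.range (k - 2)), add_zero, two_mul]
  · congr 1
    rw [← h1, ← Finset.sum_range_reflect]
    refine Finset.sum_congr rfl fun c hc => ?_
    rw [Finset.mem_range] at hc
    rw [← ncard_last_symm (c := c) (by omega)]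
    congr 2
    omega
  · intro c hc
    rw [Finset.mem_range] at hc
    rw [last_eq_empty (by omega) (by omega), Set.ncard_empty]

/-- Of the `2d+1` possible rows, the middle row `d` is its own mirror image. Nothing remains below
the removed block there, so it contributes 1, and adding 1 completes the second half of the sum. -/
theorem ncard_recursion_one (d : ℕ) :
    (withCIDiagonals (d + 1) 1).ncard + 1 =
      2 * ∑ c ∈ Finset.range (d + 1), (withCIDiagonals c 1).ncard := by
  have h1 : ∑ c ∈ Finset.range (d + 1), (withCIDiagonalsLast (d + 1) 1 c).ncard =
      ∑ c ∈ Finset.range (d + 1), (withCIDiagonals c 1).ncard := by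
    rw [← Finset.sum_range_reflect (fun c => (withCIDiagonals c 1).ncard)]
    exact Finset.sum_congr rfl fun c hc => ncard_last_of_lt le_rfl (Finset.mem_range.1 hc)
  have h2 : (withCIDiagonalsLast (d + 1) 1 d).ncard = 1 := by
    rw [ncard_last_of_lt le_rfl (Nat.lt_succ_self d), show d + 1 - 1 - d = 0 by omega, ncard_zero]
  rw [ncard_eq_sum_last (Nat.le_add_left 1 d) le_rfl,
    show 2 * (d + 1) + 1 - 2 = d + 1 + d by omega, Finset.sum_range_add, h1, add_assoc, two_mul]
  congr 1
  rw [← h1, Finset.sum_range_succ, h2, ← Finset.sum_range_reflect]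
  congr 1
  refine Finset.sum_congr rfl fun c hc => ?_
  rw [Finset.mem_range] at hc
  rw [← ncard_last_symm (c := c) (by omega)]
  congr 2
  omega

/-- Splitting off the last summand and applying the recursion to the rest yields `a (d+2) = 3 * a
(d+1)`; the same happens for `k = 1`, where the two extra ones cancel. -/
theorem two_mul_three_pow_of_recursion {a : ℕ → ℕ} (h0 : a 0 = 1)
    (h : ∀ d, a (d + 1) = 2 * ∑ c ∈ Finset.range (d + 1), a c) (d : ℕ) :
    a (d + 1) = 2 * 3 ^ d := by
  induction d with
  | zero => simp [h, h0]
  | succ d ih =>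
    rw [h, Finset.sum_range_succ, mul_add, ← h, ih]
    ring

theorem three_pow_of_recursion {a : ℕ → ℕ} (h0 : a 0 = 1)
    (h : ∀ d, a (d + 1) + 1 = 2 * ∑ c ∈ Finset.range (d + 1), a c) (d : ℕ) :
    a (d + 1) = 3 ^ d := by
  induction d with
  | zero => simpa [h0] using h 0
  | succ d ih =>
    have := h (d + 1)
    rw [Finset.sum_range_succ, mul_add, ← h, ih] at this
    rw [pow_succ]
    omega

theorem ncard_withCIDiagonals_of_one_lt {d k : ℕ} (hd : 1 ≤ d) (hk : 1 < k) :
    (withCIDiagonals d k).ncard = 2 * 3 ^ (d - 1) := by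
  obtain ⟨d, rfl⟩ := Nat.exists_eq_add_of_le' hd
  exact two_mul_three_pow_of_recursion (a := fun d => (withCIDiagonals d k).ncard) (ncard_zero k)
    (fun d => ncard_recursion_of_one_lt (Nat.le_add_left 1 d) hk) d

theorem ncard_withCIDiagonals_one {d : ℕ} (hd : 1 ≤ d) :
    (withCIDiagonals d 1).ncard = 3 ^ (d - 1) := by
  obtain ⟨d, rfl⟩ := Nat.exists_eq_add_of_le' hd
  exact three_pow_of_recursion (a := fun d => (withCIDiagonals d 1).ncard) (ncard_zero 1)
    ncard_recursion_one d

end YoungDiagram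

open MvPolynomial

/-! ### Jordan type and ranks of powers -/

section JordanType

variable {K V : Type*} [Field K] [AddCommGroup V] [Module K V]

theorem finrank_span_basis_filter {ι : Type*} [Fintype ι] (b : Module.Basis ι K V)
    (p : ι → Prop) [DecidablePred p] :
    Module.finrank K (Submodule.span K (b '' {c | p c})) = (Finset.univ.filter p).card := by
  have h := finrank_span_eq_card (R := K) (b := fun c : {c // p c} => b c)
    (b.linearIndependent.comp _ Subtype.val_injective)
  rw [show (b '' {c | p c}) = Set.range fun c : {c // p c} => b c by
    ext; simp [Set.mem_range], h, Fintype.card_subtype]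

theorem card_filter_cells (P : YoungDiagram) (p : ℕ × ℕ → Prop) [DecidablePred p] :
    ((Finset.univ : Finset {c : ℕ × ℕ // c ∈ P.cells}).filter fun c => p c.1).card =
      (P.cells.filter p).card := by
  rw [← Finset.card_map (Function.Embedding.subtype _)]
  congr 1
  ext c
  simp only [Finset.mem_map, Finset.mem_filter, Finset.mem_univ, true_and,
    Function.Embedding.subtype_apply, Subtype.exists, exists_and_left, exists_prop]
  exact ⟨fun ⟨a, h, ha, e⟩ => e ▸ ⟨ha, h⟩, fun h => ⟨c, h.2, h.1, rfl⟩⟩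

theorem HasJordanType.pow_apply {f : V →ₗ[K] V} {P : YoungDiagram}
    {b : Module.Basis {c : ℕ × ℕ // c ∈ P.cells} K V}
    (hb : ∀ c : {c : ℕ × ℕ // c ∈ P.cells},
      f (b c) = if h : (c.1.1, c.1.2 + 1) ∈ P.cells then b ⟨(c.1.1, c.1.2 + 1), h⟩ else 0)
    (t : ℕ) (c : {c : ℕ × ℕ // c ∈ P.cells}) :
    (f ^ t) (b c) = if h : (c.1.1, c.1.2 + t) ∈ P.cells then b ⟨(c.1.1, c.1.2 + t), h⟩ else 0 := by
  induction t with
  | zero => simp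
  | succ t ih =>
    rw [pow_succ', Module.End.mul_apply, ih]
    by_cases h : (c.1.1, c.1.2 + t) ∈ P.cells
    · rw [dif_pos h, hb]
      rfl
    · have h' : (c.1.1, c.1.2 + (t + 1)) ∉ P.cells := fun h' =>
        h (P.up_left_mem le_rfl (by omega) h')
      rw [dif_neg h, dif_neg h', map_zero]

theorem HasJordanType.finrank_range_pow {f : V →ₗ[K] V} {P : YoungDiagram}
    (hf : HasJordanType f P) (t : ℕ) :
    Module.finrank K (LinearMap.range (f ^ t)) = (P.cells.filter fun c => t ≤ c.2).card := by
  obtain ⟨b, hb⟩ := hf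
  have hpow := HasJordanType.pow_apply hb t
  rw [← card_filter_cells, ← finrank_span_basis_filter b]
  refine congrArg (fun S : Submodule K _ => Module.finrank K S) ?_
  apply le_antisymm
  · rw [LinearMap.range_eq_map, ← b.span_eq, Submodule.map_span, Submodule.span_le]
    rintro _ ⟨_, ⟨c, rfl⟩, rfl⟩
    rw [hpow]
    split_ifs with h
    · exact Submodule.subset_span ⟨_, Nat.le_add_left t _, rfl⟩
    · exact Submodule.zero_mem _
  · rw [Submodule.span_le]
    rintro _ ⟨⟨⟨i, j⟩, hc⟩, ht, rfl⟩
    simp only [Set.mem_ofPred_eq] at ht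
    refine ⟨b ⟨(i, j - t), P.up_left_mem le_rfl (Nat.sub_le j t) hc⟩, ?_⟩
    rw [hpow]
    simp only [Nat.sub_add_cancel ht]
    rw [dif_pos hc]

/-- Consecutive differences of these counts are the column lengths. -/
theorem YoungDiagram.eq_of_card_filter_le {P Q : YoungDiagram}
    (h : ∀ t, (P.cells.filter fun c => t ≤ c.2).card = (Q.cells.filter fun c => t ≤ c.2).card) :
    P = Q := by
  have key : ∀ (R : YoungDiagram) t, (R.cells.filter fun c => t ≤ c.2).card =
      R.colLen t + (R.cells.filter fun c => t + 1 ≤ c.2).card := by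
    intro R t
    rw [YoungDiagram.colLen_eq_card, YoungDiagram.col, ← Finset.card_union_of_disjoint]
    · congr 1
      ext c
      simp only [Finset.mem_filter, Finset.mem_union]
      have : t ≤ c.2 ↔ c.2 = t ∨ t + 1 ≤ c.2 := by omega
      tauto
    · rw [Finset.disjoint_left]
      intro c h1 h2
      rw [Finset.mem_filter] at h1 h2
      omega
  refine YoungDiagram.ext_mem fun i j => ?_
  have h1 := key P j
  have h2 := key Q j
  rw [YoungDiagram.mem_iff_lt_colLen, YoungDiagram.mem_iff_lt_colLen]
  rw [h j, h (j + 1)] at h1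
  omega

end JordanType

/-! ### Standard monomials of a graded quotient -/

section Graded

variable {K : Type*} [Field K] {I : Ideal (MvPolynomial (Fin 2) K)}

theorem quotientHilbertFunction_eq_diagonalLengths
    (hI : I.IsHomogeneous (homogeneousSubmodule (Fin 2) K)) {D : YoungDiagram}
    (h : ℕ × ℕ → MvPolynomial (Fin 2) K) (hh : ∀ c, (h c).IsHomogeneous (c.1 + c.2))
    (b : Module.Basis {c : ℕ × ℕ // c ∈ D.cells} K (MvPolynomial (Fin 2) K ⧸ I))
    (hb : ∀ c, b c = Ideal.Quotient.mk I (h c)) :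
    quotientHilbertFunction I = D.diagonalLengths := by
  ext m
  unfold quotientHilbertFunction YoungDiagram.diagonalLengths
  rw [← card_filter_cells D fun c => c.1 + c.2 = m, ← finrank_span_basis_filter b]
  refine congrArg (fun S : Submodule K _ => Module.finrank K S) ?_
  apply le_antisymm
  · rintro _ ⟨f, hf, rfl⟩
    have hf' : f.IsHomogeneous m := hf
    have hsum := b.sum_repr (Ideal.Quotient.mk I f)
    set g := b.repr (Ideal.Quotient.mk I f)
    have hmem : (∑ c, C (g c) * h c.1) - f ∈ I := by
      rw [← Ideal.Quotient.eq, ← hsum, map_sum]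
      refine Finset.sum_congr rfl fun c _ => ?_
      rw [hb, C_mul', ← Ideal.Quotient.mkₐ_eq_mk K, map_smul]
    -- Since `I` is homogeneous, the degree `m` part of the relation lies in `I`, so only basis
    -- elements of degree `m` are needed to express `f`.
    have hcomp := homogeneousComponent_mem_of_mem hI hmem m
    rw [map_sub, map_sum, homogeneousComponent_of_mem hf', if_pos rfl] at hcomp
    have hcomp' : Ideal.Quotient.mk I f = Ideal.Quotient.mk I
        (∑ c, homogeneousComponent m (C (g c) * h c.1)) := (Ideal.Quotient.eq.2 hcomp).symm
    change Ideal.Quotient.mk I f ∈ _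
    rw [hcomp', map_sum]
    refine Submodule.sum_mem _ fun c _ => ?_
    rw [homogeneousComponent_C_mul, homogeneousComponent_of_mem (hh c.1)]
    split_ifs with hc
    · rw [C_mul', ← Ideal.Quotient.mkₐ_eq_mk K, map_smul, Ideal.Quotient.mkₐ_eq_mk, ← hb]
      exact Submodule.smul_mem _ _ (Submodule.subset_span ⟨c, hc.symm, rfl⟩)
    · simp
  · rw [Submodule.span_le]
    rintro _ ⟨c, hc, rfl⟩
    refine ⟨h c.1, ?_, (hb c).symm⟩
    have := hh c.1
    rw [show c.1.1 + c.1.2 = m from hc] at this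
    exact this

/-- The exponents `(i, j)` for which `z ^ i * l ^ j` is not in `I + (l ^ (j + 1))`: when `z, l` are
coordinates, these are the standard monomials of `I` for the reverse lexicographic order. -/
noncomputable def standardDiagram (I : Ideal (MvPolynomial (Fin 2) K)) (z l : MvPolynomial (Fin 2) K)
    (M : ℕ) : YoungDiagram where
  cells := by
    classical
    exact (Finset.range M ×ˢ Finset.range M).filter fun c =>
      z ^ c.1 * l ^ c.2 ∉ I ⊔ Ideal.span {l ^ (c.2 + 1)}
  isLowerSet := by
    rintro ⟨i, j⟩ ⟨i', j'⟩ hle h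
    obtain ⟨hi, hj⟩ : i' ≤ i ∧ j' ≤ j := hle
    simp only [Finset.coe_filter, Finset.mem_product, Finset.mem_range, Set.mem_ofPred_eq] at h ⊢
    refine ⟨by omega, fun hmem => h.2 ?_⟩
    rw [Submodule.mem_sup] at hmem ⊢
    obtain ⟨u, hu, v, hv, huv⟩ := hmem
    obtain ⟨a, rfl⟩ := Ideal.mem_span_singleton.1 hv
    refine ⟨z ^ (i - i') * l ^ (j - j') * u, I.mul_mem_left _ hu,
      z ^ (i - i') * l ^ (j - j') * (l ^ (j' + 1) * a), ?_, ?_⟩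
    · rw [Ideal.mem_span_singleton]
      refine ⟨z ^ (i - i') * a, ?_⟩
      rw [show j + 1 = (j - j') + (j' + 1) by omega, pow_add]
      ring
    · rw [← mul_add, huv]
      conv_rhs => rw [← Nat.sub_add_cancel hi, ← Nat.sub_add_cancel hj, pow_add, pow_add]
      ring

/-- The cutoff `M` only makes the set of cells finite: outside the square the monomial already lies
in `I`. -/
theorem mem_standardDiagram {z l : MvPolynomial (Fin 2) K} {M : ℕ}
    (hM : ∀ i j, M ≤ i + j → z ^ i * l ^ j ∈ I) {i j : ℕ} :
    (i, j) ∈ standardDiagram I z l M ↔ z ^ i * l ^ j ∉ I ⊔ Ideal.span {l ^ (j + 1)} := by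
  rw [← YoungDiagram.mem_cells]
  simp only [standardDiagram, Finset.mem_filter, Finset.mem_product, Finset.mem_range,
    and_iff_right_iff_imp]
  intro h
  by_contra h'
  exact h (Ideal.mem_sup_left (hM i j (by omega)))

theorem linearIndependent_standard (hI : I.IsHomogeneous (homogeneousSubmodule (Fin 2) K))
    {z l : MvPolynomial (Fin 2) K} (hz : z.IsHomogeneous 1) (hl : l.IsHomogeneous 1) {M : ℕ}
    (hM : ∀ i j, M ≤ i + j → z ^ i * l ^ j ∈ I) :
    LinearIndependent K fun c : {c : ℕ × ℕ // c ∈ (standardDiagram I z l M).cells} =>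
      Ideal.Quotient.mk I (z ^ c.1.1 * l ^ c.1.2) := by
  have hh : ∀ c : ℕ × ℕ, (z ^ c.1 * l ^ c.2).IsHomogeneous (c.1 + c.2) := fun c => by
    simpa using (hz.pow c.1).mul (hl.pow c.2)
  rw [Fintype.linearIndependent_iff]
  classical
  intro g hg
  by_contra! hne
  obtain ⟨c₁, hc₁⟩ := hne
  -- Within one degree, take the term with the least power of `l`. All other terms of that degree
  -- are divisible by a higher power, so the relation puts this monomial in `I + (l^(j+1))`.
  obtain ⟨c, hc, hmin⟩ := Finset.exists_min_image
    (Finset.univ.filter fun c : {c : ℕ × ℕ // c ∈ (standardDiagram I z l M).cells} =>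
      g c ≠ 0 ∧ c.1.1 + c.1.2 = c₁.1.1 + c₁.1.2) (fun c => c.1.2)
    ⟨c₁, by simpa using hc₁⟩
  simp only [Finset.mem_filter, Finset.mem_univ, true_and] at hc hmin
  have hmem : (∑ c, C (g c) * (z ^ c.1.1 * l ^ c.1.2)) ∈ I := by
    rw [← Ideal.Quotient.eq_zero_iff_mem, ← hg, map_sum]
    refine Finset.sum_congr rfl fun c _ => ?_
    rw [C_mul', ← Ideal.Quotient.mkₐ_eq_mk K, map_smul]
  have hcomp := homogeneousComponent_mem_of_mem hI hmem (c₁.1.1 + c₁.1.2)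
  rw [map_sum, ← Finset.add_sum_erase _ _ (Finset.mem_univ c), homogeneousComponent_C_mul,
    homogeneousComponent_of_mem (hh c.1), if_pos hc.2.symm] at hcomp
  refine (mem_standardDiagram hM).1 ((YoungDiagram.mem_cells _).1 c.2) ?_
  have hrest : (∑ x ∈ Finset.univ.erase c, homogeneousComponent (c₁.1.1 + c₁.1.2)
      (C (g x) * (z ^ x.1.1 * l ^ x.1.2))) ∈ I ⊔ Ideal.span {l ^ (c.1.2 + 1)} := by
    refine Ideal.sum_mem _ fun x hx => ?_
    rw [homogeneousComponent_C_mul, homogeneousComponent_of_mem (hh x.1)]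
    split_ifs with hdeg
    · by_cases hgx : g x = 0
      · simp [hgx]
      · have hle := hmin x ⟨hgx, hdeg.symm⟩
        have hlt : c.1.2 + 1 ≤ x.1.2 := by
          rcases hle.lt_or_eq with h | h
          · exact h
          · refine absurd (Subtype.ext (Prod.ext ?_ h.symm)) (Finset.ne_of_mem_erase hx)
            have := hc.2
            omega
        refine Ideal.mem_sup_right (Ideal.mul_mem_left _ _ (Ideal.mul_mem_left _ _ ?_))
        exact Ideal.mem_span_singleton.2 (pow_dvd_pow l hlt)
    · simp
  have hfin := Submodule.sub_mem _ (Ideal.mem_sup_left hcomp) hrest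
  rw [add_sub_cancel_right] at hfin
  have := Ideal.mul_mem_left _ (C (g c)⁻¹) hfin
  rwa [← mul_assoc, ← C_mul, inv_mul_cancel₀ hc.1, C_1, one_mul] at this

/-- `z` and `l` span the linear forms. -/
def SpansLinearForms (z l : MvPolynomial (Fin 2) K) : Prop :=
  ∀ n : Fin 2, ∃ α β : K, X n = C α * z + C β * l

theorem SpansLinearForms.exists_aeval_add_mul {z l : MvPolynomial (Fin 2) K}
    (h : SpansLinearForms z l) (f : MvPolynomial (Fin 2) K) :
    ∃ (p : Polynomial K) (g : MvPolynomial (Fin 2) K), f = Polynomial.aeval z p + l * g := by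
  induction f using MvPolynomial.induction_on with
  | C a => exact ⟨Polynomial.C a, 0, by simp [algebraMap_eq]⟩
  | add f₁ f₂ h₁ h₂ =>
    obtain ⟨p₁, g₁, rfl⟩ := h₁
    obtain ⟨p₂, g₂, rfl⟩ := h₂
    exact ⟨p₁ + p₂, g₁ + g₂, by rw [map_add]; ring⟩
  | mul_X f n hf =>
    obtain ⟨p, g, rfl⟩ := hf
    obtain ⟨α, β, hX⟩ := h n
    refine ⟨p * (Polynomial.C α * Polynomial.X), Polynomial.aeval z p * C β + g * X n, ?_⟩
    rw [map_mul, map_mul, Polynomial.aeval_X, Polynomial.aeval_C, algebraMap_eq, add_mul]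
    conv_lhs => rw [hX]
    rw [hX]
    ring

/-- Descending induction on `t`. Modulo `l`, `f` is a polynomial in `z`, so `l^t f` reduces to terms
`z^i l^t` modulo `l^(t+1)`; each is standard or itself reduces to a multiple of `l^(t+1)`. -/
theorem mk_pow_mul_mem_span_standard {z l : MvPolynomial (Fin 2) K}
    (hzl : SpansLinearForms z l) {M : ℕ} (hM : ∀ i j, M ≤ i + j → z ^ i * l ^ j ∈ I)
    (n : ℕ) : ∀ t, M ≤ t + n → ∀ f, Ideal.Quotient.mk I (l ^ t * f) ∈
      Submodule.span K ((fun c : {c : ℕ × ℕ // c ∈ (standardDiagram I z l M).cells} =>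
        Ideal.Quotient.mk I (z ^ c.1.1 * l ^ c.1.2)) '' {c | t ≤ c.1.2}) := by
  induction n with
  | zero =>
    intro t ht f
    have : l ^ t * f ∈ I := I.mul_mem_right _ (by simpa using hM 0 t (by omega))
    rw [Ideal.Quotient.eq_zero_iff_mem.2 this]
    exact Submodule.zero_mem _
  | succ n ih =>
    intro t ht f
    have hstep : ∀ f, Ideal.Quotient.mk I (l ^ (t + 1) * f) ∈
      Submodule.span K ((fun c : {c : ℕ × ℕ // c ∈ (standardDiagram I z l M).cells} =>
        Ideal.Quotient.mk I (z ^ c.1.1 * l ^ c.1.2)) '' {c | t ≤ c.1.2}) := fun f =>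
      Submodule.span_mono (Set.image_mono fun c hc => Nat.le_of_succ_le hc)
        (ih (t + 1) (by omega) f)
    obtain ⟨p, g, rfl⟩ := hzl.exists_aeval_add_mul f
    rw [mul_add, map_add, ← mul_assoc, ← pow_succ]
    refine Submodule.add_mem _ ?_ (hstep g)
    rw [Polynomial.aeval_eq_sum_range, Finset.mul_sum, map_sum]
    refine Submodule.sum_mem _ fun i _ => ?_
    rw [mul_smul_comm, ← Ideal.Quotient.mkₐ_eq_mk K, map_smul, Ideal.Quotient.mkₐ_eq_mk]
    refine Submodule.smul_mem _ _ ?_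
    by_cases hi : (i, t) ∈ standardDiagram I z l M
    · rw [mul_comm]
      exact Submodule.subset_span ⟨⟨(i, t), hi⟩, le_refl t, rfl⟩
    · rw [mem_standardDiagram hM, not_not, Submodule.mem_sup] at hi
      obtain ⟨u, hu, v, hv, huv⟩ := hi
      obtain ⟨a, rfl⟩ := Ideal.mem_span_singleton.1 hv
      rw [mul_comm, ← huv, map_add, Ideal.Quotient.eq_zero_iff_mem.2 hu, zero_add]
      exact hstep a

/-- The basis of `K[x,y]/I` given by the standard monomials in `z` and `l`. -/
noncomputable def standardBasis (hI : I.IsHomogeneous (homogeneousSubmodule (Fin 2) K))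
    {z l : MvPolynomial (Fin 2) K} (hz : z.IsHomogeneous 1) (hl : l.IsHomogeneous 1)
    (hzl : SpansLinearForms z l) {M : ℕ} (hM : ∀ i j, M ≤ i + j → z ^ i * l ^ j ∈ I) :
    Module.Basis {c : ℕ × ℕ // c ∈ (standardDiagram I z l M).cells} K
      (MvPolynomial (Fin 2) K ⧸ I) :=
  Module.Basis.mk (linearIndependent_standard hI hz hl hM) (by
    rintro x -
    obtain ⟨f, rfl⟩ := Ideal.Quotient.mk_surjective x
    have := mk_pow_mul_mem_span_standard hzl hM M 0 (by omega) f
    rw [pow_zero, one_mul] at this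
    exact Submodule.span_mono (Set.image_subset_range _ _) this)

theorem standardBasis_apply (hI : I.IsHomogeneous (homogeneousSubmodule (Fin 2) K))
    {z l : MvPolynomial (Fin 2) K} (hz : z.IsHomogeneous 1) (hl : l.IsHomogeneous 1)
    (hzl : SpansLinearForms z l) {M : ℕ} (hM : ∀ i j, M ≤ i + j → z ^ i * l ^ j ∈ I)
    (c : {c : ℕ × ℕ // c ∈ (standardDiagram I z l M).cells}) :
    standardBasis hI hz hl hzl hM c = Ideal.Quotient.mk I (z ^ c.1.1 * l ^ c.1.2) := by
  simp [standardBasis]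

theorem quotientHilbertFunction_eq_standard
    (hI : I.IsHomogeneous (homogeneousSubmodule (Fin 2) K))
    {z l : MvPolynomial (Fin 2) K} (hz : z.IsHomogeneous 1) (hl : l.IsHomogeneous 1)
    (hzl : SpansLinearForms z l) {M : ℕ} (hM : ∀ i j, M ≤ i + j → z ^ i * l ^ j ∈ I) :
    quotientHilbertFunction I = (standardDiagram I z l M).diagonalLengths :=
  quotientHilbertFunction_eq_diagonalLengths hI (fun c => z ^ c.1 * l ^ c.2)
    (fun c => by simpa using (hz.pow c.1).mul (hl.pow c.2)) (standardBasis hI hz hl hzl hM)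
    (standardBasis_apply hI hz hl hzl hM)

/-- The standard basis need not be a Jordan basis, since `l` may send the end of a row to a nonzero
class; only the ranks are compared. -/
theorem finrank_range_mulLeft_pow (hI : I.IsHomogeneous (homogeneousSubmodule (Fin 2) K))
    {z l : MvPolynomial (Fin 2) K} (hz : z.IsHomogeneous 1) (hl : l.IsHomogeneous 1)
    (hzl : SpansLinearForms z l) {M : ℕ} (hM : ∀ i j, M ≤ i + j → z ^ i * l ^ j ∈ I) (t : ℕ) :
    Module.finrank K (LinearMap.range (LinearMap.mulLeft K (Ideal.Quotient.mk I l) ^ t)) =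
      ((standardDiagram I z l M).cells.filter fun c => t ≤ c.2).card := by
  rw [← card_filter_cells, ← finrank_span_basis_filter (standardBasis hI hz hl hzl hM),
    LinearMap.pow_mulLeft]
  refine congrArg (fun S : Submodule K _ => Module.finrank K S) ?_
  rw [show (standardBasis hI hz hl hzl hM : _ → _) = _ from
    funext (standardBasis_apply hI hz hl hzl hM)]
  apply le_antisymm
  · rintro _ ⟨x, rfl⟩
    obtain ⟨f, rfl⟩ := Ideal.Quotient.mk_surjective x
    rw [LinearMap.mulLeft_apply, ← map_pow, ← map_mul]
    exact mk_pow_mul_mem_span_standard hzl hM M t (by omega) f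
  · rw [Submodule.span_le]
    rintro _ ⟨c, hc, rfl⟩
    refine ⟨Ideal.Quotient.mk I (z ^ c.1.1 * l ^ (c.1.2 - t)), ?_⟩
    rw [LinearMap.mulLeft_apply, ← map_pow, ← map_mul, mul_left_comm, ← pow_add,
      Nat.add_sub_cancel' hc]

theorem exists_spansLinearForms {l : MvPolynomial (Fin 2) K} (hl : l.IsHomogeneous 1)
    (h0 : l ≠ 0) : ∃ z : MvPolynomial (Fin 2) K, z.IsHomogeneous 1 ∧ SpansLinearForms z l := by
  have hspan : l ∈ Submodule.span K (Set.range (X : Fin 2 → MvPolynomial (Fin 2) K)) := by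
    rw [← homogeneousSubmodule_one_eq_span_X]
    exact hl
  obtain ⟨g, rfl⟩ := (Submodule.mem_span_range_iff_exists_fun K).1 hspan
  simp only [Fin.sum_univ_two, smul_eq_C_mul] at h0 ⊢
  by_cases h : g 1 = 0
  · have h' : g 0 ≠ 0 := fun h' => h0 (by simp [h, h'])
    refine ⟨X 1, isHomogeneous_X K 1, fun n => ?_⟩
    fin_cases n
    · refine ⟨0, (g 0)⁻¹, ?_⟩
      simp only [h, C_0, zero_mul, add_zero, zero_add, Fin.zero_eta]
      rw [← mul_assoc, ← C_mul, inv_mul_cancel₀ h', C_1, one_mul]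
    · exact ⟨1, 0, by simp⟩
  · refine ⟨X 0, isHomogeneous_X K 0, fun n => ?_⟩
    fin_cases n
    · exact ⟨1, 0, by simp⟩
    · refine ⟨-((g 1)⁻¹ * g 0), (g 1)⁻¹, ?_⟩
      simp only [Fin.mk_one, mul_add]
      rw [← mul_assoc, ← mul_assoc, ← C_mul, ← C_mul, inv_mul_cancel₀ h, C_1, one_mul,
        ← add_assoc, ← add_mul, ← C_add, neg_add_cancel, C_0, zero_mul]
      exact (zero_add _).symm

theorem mem_of_quotientHilbertFunction_eq_zero {m : ℕ} (h : quotientHilbertFunction I m = 0)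
    {f : MvPolynomial (Fin 2) K} (hf : f.IsHomogeneous m) : f ∈ I := by
  -- `finrank` also vanishes in infinite dimension, so finiteness is needed to conclude that the
  -- component is zero.
  have hfg := (homogeneousSubmodule_fg (σ := Fin 2) (R := K) m).map
    (Ideal.Quotient.mkₐ K I).toLinearMap
  have : Module.Finite K ((homogeneousSubmodule (Fin 2) K m).map
    (Ideal.Quotient.mkₐ K I).toLinearMap) := Module.Finite.iff_fg.2 hfg
  have hbot := Submodule.finrank_eq_zero.1 h
  rw [← Ideal.Quotient.eq_zero_iff_mem, ← Submodule.mem_bot K, ← hbot]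
  exact ⟨f, hf, rfl⟩

theorem OccursAsJordanType.diagonalLengths_eq {T : ℕ → ℕ} {M : ℕ} (hT : ∀ m, M ≤ m → T m = 0)
    {P : YoungDiagram} (h : OccursAsJordanType K T P) : P.diagonalLengths = T := by
  obtain ⟨I, hI, hHilb, l, hl, h0, hJ⟩ := h
  obtain ⟨z, hz, hzl⟩ := exists_spansLinearForms hl h0
  have hM : ∀ i j, M ≤ i + j → z ^ i * l ^ j ∈ I := fun i j hij =>
    mem_of_quotientHilbertFunction_eq_zero (m := i + j) (by rw [hHilb, hT _ hij])
      (by simpa using (hz.pow i).mul (hl.pow j))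
  have hP : P = standardDiagram I z l M := YoungDiagram.eq_of_card_filter_le fun t => by
    rw [← hJ.finrank_range_pow, finrank_range_mulLeft_pow hI hz hl hzl hM]
  rw [hP, ← quotientHilbertFunction_eq_standard hI hz hl hzl hM, hHilb]

end Graded

/-! ### Monomial quotients realize every diagram -/

section Monomial

variable (K : Type*) [Field K]

/-- The ideal spanned by the monomials outside a Young diagram. -/
noncomputable def YoungDiagram.monomialIdeal (P : YoungDiagram) : Ideal (MvPolynomial (Fin 2) K) where
  carrier := {f | ∀ m : Fin 2 →₀ ℕ, (m 0, m 1) ∈ P → coeff m f = 0}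
  add_mem' := fun hf hg m hm => by rw [coeff_add, hf m hm, hg m hm, add_zero]
  zero_mem' := fun m _ => coeff_zero m
  smul_mem' := fun f g hg m hm => by
    rw [smul_eq_mul, coeff_mul]
    refine Finset.sum_eq_zero fun x hx => ?_
    have hx := Finset.HasAntidiagonal.mem_antidiagonal.1 hx
    rw [hg x.2 (P.up_left_mem (by simp [← hx]) (by simp [← hx]) hm), mul_zero]

variable {K}

theorem YoungDiagram.mem_monomialIdeal {P : YoungDiagram} {f : MvPolynomial (Fin 2) K} :
    f ∈ P.monomialIdeal K ↔ ∀ m : Fin 2 →₀ ℕ, (m 0, m 1) ∈ P → coeff m f = 0 :=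
  Iff.rfl

theorem YoungDiagram.monomialIdeal_isHomogeneous (P : YoungDiagram) :
    (P.monomialIdeal K).IsHomogeneous (homogeneousSubmodule (Fin 2) K) := by
  intro n f hf
  have : (DirectSum.decompose (homogeneousSubmodule (Fin 2) K) f n : MvPolynomial (Fin 2) K) =
      homogeneousComponent n f := decomposition.decompose'_apply f n
  rw [this]
  intro m hm
  rw [coeff_homogeneousComponent, hf m hm, ite_self]

theorem coeff_X_pow_mul_X_pow (i j : ℕ) (m : Fin 2 →₀ ℕ) :
    coeff m (X 0 ^ i * X 1 ^ j : MvPolynomial (Fin 2) K) = if m 0 = i ∧ m 1 = j then 1 else 0 := by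
  rw [X_pow_eq_monomial, X_pow_eq_monomial, monomial_mul, coeff_monomial, one_mul]
  congr 1
  rw [eq_iff_iff, Finsupp.ext_iff, Fin.forall_fin_two]
  simp [eq_comm]

theorem YoungDiagram.X_pow_mul_X_pow_mem_monomialIdeal {P : YoungDiagram} {i j : ℕ} :
    (X 0 ^ i * X 1 ^ j : MvPolynomial (Fin 2) K) ∈ P.monomialIdeal K ↔ (i, j) ∉ P := by
  simp only [mem_monomialIdeal, coeff_X_pow_mul_X_pow]
  constructor
  · intro h hP
    have := h (Finsupp.single 0 i + Finsupp.single 1 j) (by simpa using hP)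
    simp at this
  · intro h m hm
    rw [if_neg]
    rintro ⟨rfl, rfl⟩
    exact h hm

theorem YoungDiagram.standardDiagram_monomialIdeal {P : YoungDiagram} {M : ℕ}
    (hM : ∀ i j, M ≤ i + j → (X 0 ^ i * X 1 ^ j : MvPolynomial (Fin 2) K) ∈ P.monomialIdeal K) :
    standardDiagram (P.monomialIdeal K) (X 0) (X 1) M = P := by
  refine ext_mem fun i j => ?_
  rw [mem_standardDiagram hM]
  constructor
  · intro h
    by_contra hP
    exact h (Ideal.mem_sup_left (X_pow_mul_X_pow_mem_monomialIdeal.2 hP))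
  · intro hP h
    rw [Submodule.mem_sup] at h
    obtain ⟨u, hu, v, hv, huv⟩ := h
    obtain ⟨a, rfl⟩ := Ideal.mem_span_singleton.1 hv
    -- The coefficient of `x^i y^j` is 1 on the right, but 0 in `u` because `(i, j)` is in `P`, and
    -- 0 in every multiple of `y^(j+1)`.
    have hc := congrArg (coeff (Finsupp.single 0 i + Finsupp.single 1 j)) huv
    rw [coeff_X_pow_mul_X_pow, if_pos (by simp), coeff_add, hu _ (by simpa using hP), zero_add,
      X_pow_eq_monomial, coeff_monomial_mul', if_neg] at hc
    · exact zero_ne_one hc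
    · intro hle
      have := hle 1
      simp at this

theorem YoungDiagram.exists_le_notMem (P : YoungDiagram) :
    ∃ M, ∀ i j, M ≤ i + j → (i, j) ∉ P := by
  refine ⟨P.colLen 0 + P.rowLen 0, fun i j hij h => ?_⟩
  have h1 := mem_iff_lt_colLen.1 (P.up_left_mem le_rfl (Nat.zero_le j) h)
  have h2 := mem_iff_lt_rowLen.1 (P.up_left_mem (Nat.zero_le i) le_rfl h)
  omega

theorem spansLinearForms_X : SpansLinearForms (X 0 : MvPolynomial (Fin 2) K) (X 1) := fun n => by
  fin_cases n
  · exact ⟨1, 0, by simp⟩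
  · exact ⟨0, 1, by simp⟩

theorem YoungDiagram.occursAsJordanType (P : YoungDiagram) :
    OccursAsJordanType K P.diagonalLengths P := by
  obtain ⟨M, hM⟩ := P.exists_le_notMem
  have hM' : ∀ i j, M ≤ i + j → (X 0 ^ i * X 1 ^ j : MvPolynomial (Fin 2) K) ∈
      P.monomialIdeal K := fun i j hij => X_pow_mul_X_pow_mem_monomialIdeal.2 (hM i j hij)
  have hI := P.monomialIdeal_isHomogeneous (K := K)
  have hD := standardDiagram_monomialIdeal hM'
  have hb := standardBasis_apply hI (isHomogeneous_X K 0) (isHomogeneous_X K 1)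
    spansLinearForms_X hM'
  refine ⟨P.monomialIdeal K, hI, ?_, X 1, isHomogeneous_X K 1, X_ne_zero 1, ?_⟩
  · rw [quotientHilbertFunction_eq_standard hI (isHomogeneous_X K 0) (isHomogeneous_X K 1)
      spansLinearForms_X hM', hD]
  -- The index type of the basis depends on the standard diagram, so both are generalized before
  -- that diagram is identified with `P`. The monomials then form a Jordan basis for `y`.
  · generalize standardBasis hI (isHomogeneous_X K 0) (isHomogeneous_X K 1)
      spansLinearForms_X hM' = b at hb
    generalize standardDiagram (P.monomialIdeal K) (X 0) (X 1) M = D at hD b hb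
    subst hD
    refine ⟨b, fun c => ?_⟩
    have hmul : LinearMap.mulLeft K (Ideal.Quotient.mk (D.monomialIdeal K) (X 1)) (b c) =
        Ideal.Quotient.mk (D.monomialIdeal K) (X 0 ^ c.1.1 * X 1 ^ (c.1.2 + 1)) := by
      rw [hb, LinearMap.mulLeft_apply, ← map_mul, pow_succ]
      congr 1
      ring
    rw [hmul]
    split_ifs with h
    · rw [hb]
    · exact Ideal.Quotient.eq_zero_iff_mem.2 (X_pow_mul_X_pow_mem_monomialIdeal.2 h)

end Monomial

theorem ciHilbertFunction_eq_zero {d k m : ℕ} (hd : 1 ≤ d) (hk : 1 ≤ k) (hm : 2 * d + k ≤ m) :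
    ciHilbertFunction d k m = 0 := by
  unfold ciHilbertFunction
  split_ifs <;> omega

theorem corollary2p6 (K : Type*) [Field K] (d k : ℕ) (hd : 1 ≤ d) (hk : 1 ≤ k) :
    (1 < k →
      {P : YoungDiagram | P.diagonalLengths = ciHilbertFunction d k}.ncard = 2 * 3 ^ (d - 1)) ∧
    (k = 1 →
      {P : YoungDiagram | P.diagonalLengths = ciHilbertFunction d k}.ncard = 3 ^ (d - 1)) ∧
    {P : YoungDiagram | P.diagonalLengths = ciHilbertFunction d k} =
      {P : YoungDiagram | OccursAsJordanType K (ciHilbertFunction d k) P} := by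
  refine ⟨fun hk1 => YoungDiagram.ncard_withCIDiagonals_of_one_lt hd hk1, ?_, ?_⟩
  · rintro rfl
    exact YoungDiagram.ncard_withCIDiagonals_one hd
  · ext P
    constructor
    · intro hP
      have hP' : P.diagonalLengths = ciHilbertFunction d k := hP
      have := P.occursAsJordanType (K := K)
      rw [hP'] at this
      exact this
    · intro hP
      exact OccursAsJordanType.diagonalLengths_eq
        (fun m hm => ciHilbertFunction_eq_zero hd hk hm) hP
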